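/- Let $p$ be an odd prime, let $s,n$ be positive integers, let $\mathbb F_q$ be a finite field of characteristic $p$, and let $\lambda,\xi,\psi\in\mathbb F_q\setminus\{0\}$ with $\lambda=\psi^{p^s}$. Suppose that $x^{2n}-\psi=(x^n-\xi)(x^n+\xi)$, where $x^n-\xi$ and $x^n+\xi$ are irreducible over $\mathbb F_q$. Put $N=2np^s$ and $\mathcal R=\mathbb F_q[x]/\langle x^{N}-\lambda\rangle$. A $\lambda$-cyclic (or $\lambda$-constacyclic) code of length $N$ over $\mathbb F_q$ is a linear subspace of $\mathbb F_q^{N}$ that is closed under $(c_0,\dots,c_{N-1})\mapsto(\lambda c_{N-1},c_0,\dots,c_{N-2})$. A word $(c_0,\dots,c_{N-1})$ is identified with the class of $c_0+c_1x+\dots+c_{N-1}x^{N-1}$ in $\mathcal R$, so that ideals of $\mathcal R$ are regarded as codes. The minimum Hamming distance $d_H(C)$ of a code $C$ is the least Hamming distance between two distinct words of $C$. Then the $\lambda$-cyclic codes of length $N$ over $\mathbb F_q$ are exactly the ideals $$C_{i,j}=\langle (x^n-\xi)^i(x^n+\xi)^j\rangle\subseteq\mathcal R,\qquad 0\le i,j\le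 p^s .$$ Moreover, $C_{0,0}=\mathbb F_q^{N}$ and $C_{p^s,p^s}=\{0\}$. For integers $\beta,k,\tau$ with $1\le\beta\le p-2$, $1\le k\le s-1$ and $1\le\tau\le p-1$, put $$B_\beta=\{m\in\mathbb Z:\ \beta p^{s-1}+1\le m\le(\beta+1)p^{s-1}\},$$ $$T_{k,\tau}=\{m\in\mathbb Z:\ p^s-p^{s-k}+(\tau-1)p^{s-k-1}+1\le m\le p^s-p^{s-k}+\tau p^{s-k-1}\}.$$ For every pair $(i,j)$ with $0\le i,j\le p^s$ other than $(0,0)$ and $(p^s,p^s)$, at least one of the following cases applies to $(i,j)$ or to $(j,i)$ in place of $(i,j)$, and whenever a case applies to $(i,j)$ or to $(j,i)$, the number $d_H(C_{i,j})$ has the value given in that case (all parameters $\beta,\beta',k,k',k'',\tau,\tau_1,\dots,\tau_4$ lie in the ranges above): 1. $0<i\le p^s$, $j=0$: $d_H=2$. 2. $0\le i\le p^{s-1}$, $0\le j\le p^{s-1}$: $d_H=2$. 3. $p^{s-1}<i\le 2p^{s-1}$, $0<j\le p^{s-1}$: $d_H=3$. 4. $2p^{s-1}<i\le p^s$, $0<j\le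 p^{s-1}$: $d_H=4$. 5. $i\in B_\beta$, $j\in B_{\beta'}$ with $\beta'\le\beta$: $d_H=\min\{\beta+2,\,2(\beta'+2)\}$. 6. $i\in T_{k,\tau}$, $j\in B_\beta$: $d_H=2(\beta+2)$. 7. $i,j\in T_{k,\tau}$: $d_H=(\tau+1)p^k$. 8. $i\in T_{k,\tau_1}$, $j\in T_{k,\tau_2}$ with $\tau_2<\tau_1$: $d_H=\min\{2(\tau_2+1)p^k,\,(\tau_1+1)p^k\}$. 9. $i\in T_{k',\tau_3}$, $j\in T_{k'',\tau_4}$ with $k''<k'$: $d_H=2(\tau_4+1)p^{k''}$. 10. $i=p^s$, $j\in B_\beta$: $d_H=2(\beta+2)$. 11. $i=p^s$, $j\in T_{k,\tau}$: $d_H=2(\tau+1)p^k$. (The case $n=1$ covers the cyclic codes of length $2p^s$, with $\psi=\xi=1$, and, when $-1=\xi^2$ is a square in $\mathbb F_q$, the negacyclic codes of length $2p^s$, with $\psi=-1$.) -/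

import Mathlib

open Polynomial

namespace Constacyclic

/-- The `lam`-shift `(c₀, c₁, …, c_{N-1}) ↦ (lam * c_{N-1}, c₀, …, c_{N-2})`. -/
def shift {F : Type*} [Field F] {N : ℕ} (lam : F) (c : Fin N → F) : Fin N → F := fun i =>
  if (i : ℕ) = 0 then lam * c ⟨N - 1, by have := i.isLt; omega⟩
  else c ⟨(i : ℕ) - 1, by have := i.isLt; omega⟩

/-- A linear code of length `N` over `F` is a `lam`-cyclic (`lam`-constacyclic) code if it is
closed under `lam`-shifts. -/
def IsConstacyclic {F : Type*} [Field F] {N : ℕ} (lam : F) (D : Submodule F (Fin N → F)) : Prop :=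
  ∀ c ∈ D, shift lam c ∈ D

/-- The ring `F[x] / ⟨x ^ N - lam⟩`. -/
abbrev QuotRing {F : Type*} [Field F] (N : ℕ) (lam : F) : Type _ :=
  F[X] ⧸ Ideal.span {(X ^ N - C lam : F[X])}

/-- The polynomial `c₀ + c₁ x + ⋯ + c_{N-1} x ^ (N-1)` of a codeword. -/
noncomputable def wordPoly {F : Type*} [Field F] {N : ℕ} (c : Fin N → F) : F[X] :=
  ∑ i : Fin N, C (c i) * X ^ (i : ℕ)

/-- The class in `F[x] / ⟨x ^ N - lam⟩` of the polynomial of a codeword, as a linear map. -/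
noncomputable def wordClass {F : Type*} [Field F] (N : ℕ) (lam : F) :
    (Fin N → F) →ₗ[F] QuotRing N lam where
  toFun c := Ideal.Quotient.mk _ (wordPoly c)
  map_add' c d := by
    rw [← map_add]
    congr 1
    simp [wordPoly, add_mul, Finset.sum_add_distrib]
  map_smul' a c := by
    have h : wordPoly (a • c) = a • wordPoly c := by
      simp [wordPoly, Finset.smul_sum, Polynomial.smul_eq_C_mul, mul_assoc]
    rw [h]
    rfl

/-- The code of length `N` that corresponds to an ideal of `F[x] / ⟨x ^ N - lam⟩`: the codewords
whose polynomial represents an element of the ideal. -/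
noncomputable def codeOfIdeal {F : Type*} [Field F] {N : ℕ} {lam : F} (I : Ideal (QuotRing N lam)) :
    Submodule F (Fin N → F) :=
  (I.restrictScalars F).comap (wordClass N lam)

/-- The code `⟨(x ^ n - ξ) ^ i * (x ^ n + ξ) ^ j⟩` in `F[x] / ⟨x ^ N - lam⟩`. -/
noncomputable def genCode {F : Type*} [Field F] (N : ℕ) (lam : F) (n : ℕ) (ξ : F) (i j : ℕ) :
    Submodule F (Fin N → F) :=
  codeOfIdeal (N := N) (lam := lam)
    (Ideal.span {Ideal.Quotient.mk _ ((X ^ n - C ξ) ^ i * (X ^ n + C ξ) ^ j)})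

/-- `d` is the minimum Hamming distance of the code `D`: the minimum (attained) of the Hamming
distances of two distinct codewords. -/
def IsMinHammingDist {F : Type*} [Field F] [DecidableEq F] {N : ℕ}
    (D : Submodule F (Fin N → F)) (d : ℕ) : Prop :=
  IsLeast {w : ℕ | ∃ u ∈ D, ∃ v ∈ D, u ≠ v ∧ hammingDist u v = w} d

/-- `β p^(s-1) + 1 ≤ i ≤ (β + 1) p^(s-1)`, where `1 ≤ β ≤ p - 2`. -/
def InBeta (p s β i : ℕ) : Prop :=
  (1 ≤ β ∧ β ≤ p - 2) ∧ β * p ^ (s - 1) + 1 ≤ i ∧ i ≤ (β + 1) * p ^ (s - 1)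

/-- `p^s - p^(s-k) + (τ - 1) p^(s-k-1) + 1 ≤ i ≤ p^s - p^(s-k) + τ p^(s-k-1)`, where
`1 ≤ τ ≤ p - 1` and `1 ≤ k ≤ s - 1`. No subtraction of natural numbers is truncated here. -/
def InTau (p s k τ i : ℕ) : Prop :=
  (1 ≤ τ ∧ τ ≤ p - 1) ∧ (1 ≤ k ∧ k ≤ s - 1) ∧
    p ^ s - p ^ (s - k) + (τ - 1) * p ^ (s - k - 1) + 1 ≤ i ∧
    i ≤ p ^ s - p ^ (s - k) + τ * p ^ (s - k - 1)

/-- The rows of the table of distances: `Row p s i j d` says that one of the eleven rows applies to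
the pair `(i, j)`, and that `d` is the value in that row. -/
inductive Row (p s : ℕ) : ℕ → ℕ → ℕ → Prop
  | case1 {i : ℕ} (hi : 0 < i ∧ i ≤ p ^ s) : Row p s i 0 2
  | case2 {i j : ℕ} (hi : i ≤ p ^ (s - 1)) (hj : j ≤ p ^ (s - 1)) : Row p s i j 2
  | case3 {i j : ℕ} (hi : p ^ (s - 1) < i ∧ i ≤ 2 * p ^ (s - 1))
      (hj : 0 < j ∧ j ≤ p ^ (s - 1)) : Row p s i j 3
  | case4 {i j : ℕ} (hi : 2 * p ^ (s - 1) < i ∧ i ≤ p ^ s)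
      (hj : 0 < j ∧ j ≤ p ^ (s - 1)) : Row p s i j 4
  | case5 {i j β β' : ℕ} (hββ : β' ≤ β) (hi : InBeta p s β i) (hj : InBeta p s β' j) :
      Row p s i j (min (β + 2) (2 * (β' + 2)))
  | case6 {i j k τ β : ℕ} (hi : InTau p s k τ i) (hj : InBeta p s β j) :
      Row p s i j (2 * (β + 2))
  | case7 {i j k τ : ℕ} (hi : InTau p s k τ i) (hj : InTau p s k τ j) :
      Row p s i j ((τ + 1) * p ^ k)
  | case8 {i j k τ₁ τ₂ : ℕ} (hττ : τ₂ < τ₁) (hi : InTau p s k τ₁ i) (hj : InTau p s k τ₂ j) :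
      Row p s i j (min (2 * (τ₂ + 1) * p ^ k) ((τ₁ + 1) * p ^ k))
  | case9 {i j k' k'' τ₃ τ₄ : ℕ} (hkk : k'' < k') (hi : InTau p s k' τ₃ i)
      (hj : InTau p s k'' τ₄ j) : Row p s i j (2 * (τ₄ + 1) * p ^ k'')
  | case10 {j β : ℕ} (hj : InBeta p s β j) : Row p s (p ^ s) j (2 * (β + 2))
  | case11 {j k τ : ℕ} (hj : InTau p s k τ j) : Row p s (p ^ s) j (2 * (τ + 1) * p ^ k)

/-- The table of distances: each row holds as it stands, and with `i` and `j` exchanged. -/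
def Table (p s i j d : ℕ) : Prop := Row p s i j d ∨ Row p s j i d

end Constacyclic

/-!
The weight of a word is the number of nonzero coefficients of its polynomial. Write `f = X ^ n - ξ`
and `g = X ^ n + ξ`, so that `f * g = X ^ (2 * n) - ψ` and
`X ^ (2 * n * p ^ s) - λ = f ^ (p ^ s) * g ^ (p ^ s)` in characteristic `p`. Since `F[X]` is a
principal ideal ring, a constacyclic code is given by a divisor of this polynomial
(`IsConstacyclic.exists_dvd`), and as `f` and `g` are irreducible the divisors are, up to units, the
products `f ^ i * g ^ j`.

The distances come from Massey's weight bound. Let `digitProd p t` be the product of the numbers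
`dᵢ + 1` over the base-`p` digits `dᵢ` of `t`. If `(X - a) ^ t` exactly divides a polynomial, with
`a ≠ 0`, then that polynomial has at least `digitProd p t` terms (`digitProd_le_card_support`): write
`t = p * q + r`, split the exponents into residue classes modulo `p`, apply induction to `q` in each
class, and count the nonvanishing classes through the remainder modulo `(X - a) ^ p`, which has
degree less than `p` and is divisible by `(X - a) ^ r`. Splitting exponents modulo `2 * n` instead
shows that `(f * g) ^ t * v` has at least `digitProd p t` times as many terms as the remainder of `v`
modulo `f * g` (`mul_card_support_reduceMod_le`). Taking `t` maximal, that remainder is nonzero, and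
it has at least two terms unless `t ≥ max i j`; moreover `t ≥ min i j` always. The words
`(f * g) ^ t`, `f ^ (p ^ s) * g ^ t` and `f ^ t * g ^ (p ^ s)` attain these bounds. Hence the distance
is the minimum of `2 * digitProd p t` over `min i j ≤ t < p ^ s` and of `digitProd p t` over
`max i j ≤ t < p ^ s` (`IsDigitMin`).

It remains to read off the table (`Row.isDigitMin`). The ranges `B_β` and `T_{k,τ}`, as well as
`0 < i ≤ p ^ (s - 1)`, are instances of one family of levels (`InLevel`), on which the minimum of
`digitProd p t` over `i ≤ t < p ^ s` is `(a + 2) * p ^ k` (`InLevel.isLeast`), and these levels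
cover all `0 < i < p ^ s` (`exists_inLevel`).
-/

/-! ### The product of the incremented digits -/

/-- The product of `dᵢ + 1` over the base-`p` digits `dᵢ` of `t`. In characteristic `p` this is the
number of nonzero coefficients of `(X - a) ^ t` for `a ≠ 0`. -/
def digitProd (p t : ℕ) : ℕ := ((Nat.digits p t).map (· + 1)).prod

@[simp] lemma digitProd_zero (p : ℕ) : digitProd p 0 = 1 := by simp [digitProd]

lemma digitProd_mul_add {p : ℕ} (hp : 1 < p) (q : ℕ) {r : ℕ} (hr : r < p) :
    digitProd p (p * q + r) = (r + 1) * digitProd p q := by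
  by_cases h : r = 0 ∧ q = 0
  · obtain ⟨rfl, rfl⟩ := h
    simp
  · have h' : r ≠ 0 ∨ q ≠ 0 := by tauto
    rw [digitProd, add_comm, Nat.digits_add p hp r q hr h']
    simp [digitProd]

lemma digitProd_pos (p t : ℕ) : 0 < digitProd p t := by
  refine Nat.pos_of_ne_zero fun h => ?_
  rw [digitProd, List.prod_eq_zero_iff] at h
  simp at h

/-- Splitting off the top digit. -/
lemma digitProd_top {p : ℕ} (hp : 1 < p) {a : ℕ} (ha : a < p) (m b : ℕ) (hb : b < p ^ m) :
    digitProd p (a * p ^ m + b) = (a + 1) * digitProd p b := by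
  induction m generalizing b with
  | zero =>
    obtain rfl : b = 0 := by simpa using hb
    have := digitProd_mul_add hp 0 ha
    simpa using this
  | succ m ih =>
    have hb' : b / p < p ^ m := Nat.div_lt_of_lt_mul (by rwa [pow_succ'] at hb)
    have hr : b % p < p := Nat.mod_lt _ (by omega)
    have e : a * p ^ (m + 1) + b = p * (a * p ^ m + b / p) + b % p := by
      conv_lhs => rw [← Nat.div_add_mod b p]
      ring
    have e' : digitProd p b = (b % p + 1) * digitProd p (b / p) := by
      rw [← digitProd_mul_add hp _ hr, Nat.div_add_mod]
    rw [e, digitProd_mul_add hp _ hr, ih _ hb', e']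
    ring

lemma two_le_digitProd {p : ℕ} (hp : 1 < p) {t : ℕ} (ht : 0 < t) : 2 ≤ digitProd p t := by
  induction t using Nat.strong_induction_on with
  | _ t ih =>
    have hr : t % p < p := Nat.mod_lt _ (by omega)
    have e : digitProd p t = (t % p + 1) * digitProd p (t / p) := by
      rw [← digitProd_mul_add hp _ hr, Nat.div_add_mod]
    rw [e]
    rcases Nat.eq_zero_or_pos (t % p) with h0 | h0
    · have hq : 0 < t / p := by
        refine Nat.pos_of_ne_zero fun h => ?_
        have := Nat.div_add_mod t p
        rw [h, h0] at this
        omega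
      have := ih _ (Nat.div_lt_self ht hp) hq
      rw [h0]; omega
    · have := digitProd_pos p (t / p)
      nlinarith

/-- An exponent that exceeds the number with base-`p` digits `p-1, …, p-1, a, 0, …, 0` (`k` leading
digits `p - 1`, `m` trailing zeros) has digit product at least `(a + 2) p ^ k`. -/
lemma le_digitProd {p : ℕ} (hp : 1 < p) (k m a t : ℕ) (ht : t < p ^ (m + 1 + k))
    (h : p ^ (m + 1 + k) + a * p ^ m < t + p ^ (m + 1)) : (a + 2) * p ^ k ≤ digitProd p t := by
  induction k generalizing t with
  | zero =>
    have hm : 0 < p ^ m := by positivity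
    have hb := Nat.mod_lt t hm
    have e := Nat.div_add_mod' t (p ^ m)
    have hlt : t / p ^ m < p := Nat.div_lt_of_lt_mul (by simpa [pow_succ] using ht)
    have ht' := digitProd_top hp hlt m _ hb
    rw [e] at ht'
    have hat : a * p ^ m < t := by simp only [add_zero] at h; omega
    have hle : a ≤ t / p ^ m := (Nat.le_div_iff_mul_le hm).2 hat.le
    rw [ht', pow_zero, mul_one]
    rcases hle.lt_or_eq with h1 | h1
    · have := digitProd_pos p (t % p ^ m)
      nlinarith
    · have h2 : 0 < t % p ^ m := by
        rw [← h1] at e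
        omega
      have := two_le_digitProd hp h2
      rw [← h1]
      nlinarith
  | succ k ih =>
    have hpow : p ^ (m + 1 + (k + 1)) = (p - 1) * p ^ (m + 1 + k) + p ^ (m + 1 + k) := by
      obtain ⟨q, rfl⟩ : ∃ q, p = q + 1 := ⟨p - 1, by omega⟩
      rw [Nat.add_sub_cancel]; ring
    have hle : p ^ (m + 1) ≤ p ^ (m + 1 + k) := Nat.pow_le_pow_right (by omega) (by omega)
    obtain ⟨b, rfl⟩ : ∃ b, t = (p - 1) * p ^ (m + 1 + k) + b :=
      ⟨t - (p - 1) * p ^ (m + 1 + k), by omega⟩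
    have hb : b < p ^ (m + 1 + k) := by omega
    rw [digitProd_top hp (by omega) _ _ hb, Nat.sub_add_cancel hp.le]
    have := ih b hb (by omega)
    calc (a + 2) * p ^ (k + 1) = p * ((a + 2) * p ^ k) := by ring
      _ ≤ _ := Nat.mul_le_mul_left _ this

lemma digitProd_eq {p : ℕ} (hp : 1 < p) (k m a t : ℕ) (ha : a < p)
    (h : t + p ^ (m + 1) = p ^ (m + 1 + k) + a * p ^ m) : digitProd p t = (a + 1) * p ^ k := by
  have hap : a * p ^ m < p ^ (m + 1) := by
    rw [pow_succ']
    exact Nat.mul_lt_mul_of_pos_right ha (by positivity)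
  induction k generalizing t with
  | zero =>
    have := digitProd_top hp ha m 0 (by positivity)
    simp only [add_zero] at h
    obtain rfl : t = a * p ^ m := by omega
    simpa using this
  | succ k ih =>
    have hpow : p ^ (m + 1 + (k + 1)) = (p - 1) * p ^ (m + 1 + k) + p ^ (m + 1 + k) := by
      obtain ⟨q, rfl⟩ : ∃ q, p = q + 1 := ⟨p - 1, by omega⟩
      rw [Nat.add_sub_cancel]; ring
    have hle : p ^ (m + 1) ≤ p ^ (m + 1 + k) := Nat.pow_le_pow_right (by omega) (by omega)
    obtain ⟨b, rfl⟩ : ∃ b, t = (p - 1) * p ^ (m + 1 + k) + b :=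
      ⟨t - (p - 1) * p ^ (m + 1 + k), by omega⟩
    have hb : b < p ^ (m + 1 + k) := by omega
    rw [digitProd_top hp (by omega) _ _ hb, Nat.sub_add_cancel hp.le, ih b (by omega)]
    ring

/-! ### The rows of the table in terms of digit products -/

/-- The common form of the ranges `B_β` (`k = 0`, `a = β`) and `T_{k,τ}` (`a = τ - 1`):
`p^s - p^(s-k) + a p^(s-k-1) < i ≤ p^s - p^(s-k) + (a + 1) p^(s-k-1)` with `a + 1 < p`, written
without subtraction through `m = s - k - 1`. For `k = a = 0` it is the range
`0 < i ≤ p^(s-1)`. -/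
def InLevel (p s k a i : ℕ) : Prop :=
  ∃ m, s = m + 1 + k ∧ a + 1 < p ∧ p ^ s + a * p ^ m < i + p ^ (m + 1) ∧
    i + p ^ (m + 1) ≤ p ^ s + (a + 1) * p ^ m

lemma InLevel.isLeast {p : ℕ} {s k a i : ℕ} (h : InLevel p s k a i) :
    IsLeast (digitProd p '' {t | i ≤ t ∧ t < p ^ s}) ((a + 2) * p ^ k) := by
  obtain ⟨m, rfl, ha, h1, h2⟩ := h
  have hp : 1 < p := by omega
  have hle : p ^ (m + 1) ≤ p ^ (m + 1 + k) := Nat.pow_le_pow_right (by omega) (by omega)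
  have hap : (a + 1) * p ^ m < p ^ (m + 1) := by
    rw [pow_succ']
    exact Nat.mul_lt_mul_of_pos_right ha (by positivity)
  constructor
  · refine ⟨p ^ (m + 1 + k) + (a + 1) * p ^ m - p ^ (m + 1), ⟨by omega, by omega⟩, ?_⟩
    exact digitProd_eq hp k m (a + 1) _ ha (by omega)
  · rintro _ ⟨t, ⟨ht1, ht2⟩, rfl⟩
    exact le_digitProd hp k m a t ht2 (by omega)

lemma exists_inLevel {p : ℕ} (hp : 1 < p) (s i : ℕ) (h0 : 0 < i) (hi : i < p ^ s) :
    ∃ k a, InLevel p s k a i := by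
  induction s generalizing i with
  | zero => simp at hi; omega
  | succ s ih =>
    have hs : 0 < p ^ s := by positivity
    have hpow : p ^ (s + 1) = (p - 1) * p ^ s + p ^ s := by
      obtain ⟨q, rfl⟩ : ∃ q, p = q + 1 := ⟨p - 1, by omega⟩
      rw [Nat.add_sub_cancel]; ring
    rcases le_or_gt i ((p - 1) * p ^ s) with h | h
    · have e := Nat.div_add_mod' (i - 1) (p ^ s)
      have hb := Nat.mod_lt (i - 1) hs
      have ha : (i - 1) / p ^ s < p - 1 := (Nat.div_lt_iff_lt_mul hs).2 (by omega)
      generalize (i - 1) / p ^ s = q at *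
      generalize (i - 1) % p ^ s = r at *
      exact ⟨0, q, s, rfl, by omega, by omega, by rw [add_mul]; omega⟩
    · obtain ⟨b, rfl⟩ : ∃ b, i = (p - 1) * p ^ s + b := ⟨i - (p - 1) * p ^ s, by omega⟩
      obtain ⟨k, a, m, rfl, ha, h1, h2⟩ := ih b (by omega) (by omega)
      exact ⟨k + 1, a, m, by ring, ha, by omega, by omega⟩

namespace Constacyclic

lemma inBeta_iff {p s β i : ℕ} (hs : 0 < s) :
    InBeta p s β i ↔ 1 ≤ β ∧ InLevel p s 0 β i := by
  obtain ⟨m, rfl⟩ : ∃ m, s = m + 1 := ⟨s - 1, by omega⟩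
  simp only [InBeta, InLevel, Nat.add_sub_cancel, add_zero]
  constructor
  · rintro ⟨⟨h1, h2⟩, h3, h4⟩
    exact ⟨h1, m, rfl, by omega, by omega, by omega⟩
  · rintro ⟨h1, m', hm, h2, h3, h4⟩
    obtain rfl : m = m' := by omega
    exact ⟨⟨h1, by omega⟩, by omega, by omega⟩

lemma inTau_iff {p s k a i : ℕ} (hp : 1 < p) (hs : 0 < s) :
    InTau p s k (a + 1) i ↔ 1 ≤ k ∧ InLevel p s k a i := by
  simp only [InTau, InLevel, Nat.add_sub_cancel]
  constructor
  · rintro ⟨⟨h1, h2⟩, ⟨h3, h4⟩, h5, h6⟩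
    obtain ⟨m, rfl⟩ : ∃ m, s = m + 1 + k := ⟨s - 1 - k, by omega⟩
    have hle : p ^ (m + 1) ≤ p ^ (m + 1 + k) := Nat.pow_le_pow_right (by omega) (by omega)
    simp only [Nat.add_sub_cancel] at h5 h6
    exact ⟨h3, m, rfl, by omega, by omega, by omega⟩
  · rintro ⟨h3, m, rfl, h4, h5, h6⟩
    have hle : p ^ (m + 1) ≤ p ^ (m + 1 + k) := Nat.pow_le_pow_right (by omega) (by omega)
    simp only [Nat.add_sub_cancel]
    exact ⟨⟨by omega, by omega⟩, ⟨h3, by omega⟩, by omega, by omega⟩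

lemma InTau.inLevel {p s k τ i : ℕ} (h : InTau p s k τ i) :
    ∃ a, τ = a + 1 ∧ 1 ≤ k ∧ InLevel p s k a i := by
  obtain ⟨a, rfl⟩ : ∃ a, τ = a + 1 := ⟨τ - 1, by have := h.1.1; omega⟩
  have h1 := h.1
  have h2 := h.2.1
  exact ⟨a, rfl, (inTau_iff (by omega) (by omega)).1 h⟩

lemma inLevel_zero_zero {p s i : ℕ} (hp : 2 < p) (hs : 0 < s) :
    InLevel p s 0 0 i ↔ 0 < i ∧ i ≤ p ^ (s - 1) := by
  obtain ⟨m, rfl⟩ : ∃ m, s = m + 1 := ⟨s - 1, by omega⟩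
  simp only [InLevel, Nat.add_sub_cancel, add_zero]
  constructor
  · rintro ⟨m', hm, h2, h3, h4⟩
    obtain rfl : m = m' := by omega
    omega
  · rintro ⟨h1, h2⟩
    exact ⟨m, rfl, by omega, by omega, by omega⟩

/-- `d` is the minimum of the numbers `2 * digitProd p t` with `min i j ≤ t < p ^ s` and
`digitProd p t` with `max i j ≤ t < p ^ s`. -/
structure IsDigitMin (p s i j d : ℕ) : Prop where
  le_two_mul : ∀ t, min i j ≤ t → t < p ^ s → d ≤ 2 * digitProd p t
  le : ∀ t, max i j ≤ t → t < p ^ s → d ≤ digitProd p t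
  attained : (∃ t, min i j ≤ t ∧ t < p ^ s ∧ 2 * digitProd p t ≤ d) ∨
    ∃ t, max i j ≤ t ∧ t < p ^ s ∧ digitProd p t ≤ d

lemma IsDigitMin.symm {p s i j d : ℕ} (h : IsDigitMin p s i j d) : IsDigitMin p s j i d := by
  obtain ⟨h1, h2, h3⟩ := h
  rw [min_comm] at h1 h3
  rw [max_comm] at h2 h3
  exact ⟨h1, h2, h3⟩

lemma isDigitMin_of_isLeast {p s i j A B : ℕ} (hji : j ≤ i)
    (hA : IsLeast (digitProd p '' {t | i ≤ t ∧ t < p ^ s}) A)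
    (hB : IsLeast (digitProd p '' {t | j ≤ t ∧ t < p ^ s}) B) :
    IsDigitMin p s i j (min A (2 * B)) := by
  obtain ⟨⟨t, ⟨ht1, ht2⟩, ht⟩, hA⟩ := hA
  obtain ⟨⟨u, ⟨hu1, hu2⟩, hu⟩, hB⟩ := hB
  refine ⟨fun v hv hv' => ?_, fun v hv hv' => ?_, ?_⟩
  · rw [min_eq_right hji] at hv
    exact (min_le_right _ _).trans (Nat.mul_le_mul_left _ (hB ⟨v, ⟨hv, hv'⟩, rfl⟩))
  · rw [max_eq_left hji] at hv
    exact (min_le_left _ _).trans (hA ⟨v, ⟨hv, hv'⟩, rfl⟩)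
  · rw [min_eq_right hji, max_eq_left hji]
    rcases le_total A (2 * B) with h | h
    · exact Or.inr ⟨t, ht1, ht2, by rw [min_eq_left h, ht]⟩
    · exact Or.inl ⟨u, hu1, hu2, by rw [min_eq_right h, hu]⟩

lemma isDigitMin_two_mul {p s i j B : ℕ} (hji : j ≤ i)
    (hA : ∀ t, i ≤ t → t < p ^ s → 2 * B ≤ digitProd p t)
    (hB : IsLeast (digitProd p '' {t | j ≤ t ∧ t < p ^ s}) B) :
    IsDigitMin p s i j (2 * B) := by
  obtain ⟨⟨u, ⟨hu1, hu2⟩, hu⟩, hB⟩ := hB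
  refine ⟨fun v hv hv' => ?_, fun v hv hv' => ?_, ?_⟩
  · rw [min_eq_right hji] at hv
    exact Nat.mul_le_mul_left _ (hB ⟨v, ⟨hv, hv'⟩, rfl⟩)
  · rw [max_eq_left hji] at hv
    exact hA v hv hv'
  · rw [min_eq_right hji]
    exact Or.inl ⟨u, hu1, hu2, by rw [hu]⟩

/-- If `i` and `j` lie in the same level, their order does not matter. -/
lemma isDigitMin_of_same {p s i j A : ℕ}
    (hA : IsLeast (digitProd p '' {t | i ≤ t ∧ t < p ^ s}) A)
    (hB : IsLeast (digitProd p '' {t | j ≤ t ∧ t < p ^ s}) A) :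
    IsDigitMin p s i j A := by
  have e : min A (2 * A) = A := by omega
  rcases le_total j i with h | h
  · simpa [e] using isDigitMin_of_isLeast h hA hB
  · simpa [e] using (isDigitMin_of_isLeast h hB hA).symm

/-- Levels are ordered lexicographically. -/
lemma lt_of_inLevel {p s k k' a a' i j : ℕ} (hi : InLevel p s k a i) (hj : InLevel p s k' a' j)
    (h : k' < k ∨ k' = k ∧ a' < a) : j < i := by
  by_contra! hij
  have h1 := hi.isLeast
  have h2 := hj.isLeast
  have hp : 1 < p := by obtain ⟨m, -, h, -⟩ := hi; omega
  have ha' : a' + 1 < p := by obtain ⟨m, -, h, -⟩ := hj; exact h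
  have : (a + 2) * p ^ k ≤ (a' + 2) * p ^ k' := by
    obtain ⟨t, ⟨ht1, ht2⟩, ht⟩ := h2.1
    rw [← ht]
    exact h1.2 ⟨t, ⟨hij.trans ht1, ht2⟩, rfl⟩
  rcases h with h | ⟨rfl, h⟩
  · have h3 : p ^ k' * p ≤ p ^ k := by
      rw [← pow_succ]
      exact Nat.pow_le_pow_right (by omega) h
    have h4 : 0 < p ^ k' := by positivity
    have h5 : (a' + 2) * p ^ k' ≤ p ^ k' * p := by
      rw [mul_comm]
      exact Nat.mul_le_mul_left _ (by omega)
    have h6 : 2 * p ^ k ≤ (a + 2) * p ^ k := Nat.mul_le_mul_right _ (by omega)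
    have h7 : 0 < p ^ k := by positivity
    omega
  · have h4 : 0 < p ^ k' := by positivity
    nlinarith

lemma isLeast_digitProd_zero {p s : ℕ} (hp : 1 < p) :
    IsLeast (digitProd p '' {t | 0 ≤ t ∧ t < p ^ s}) 1 := by
  refine ⟨⟨0, ⟨le_rfl, by positivity⟩, digitProd_zero p⟩, ?_⟩
  rintro _ ⟨t, -, rfl⟩
  exact digitProd_pos p t

/-- The pair `(0, 0)` satisfies the conditions of the second row, but the whole space has
distance `1`. -/
lemma Row.isDigitMin {p s i j d : ℕ} (hp : 2 < p) (hs : 0 < s) (h : Row p s i j d)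
    (h0 : (i, j) ≠ (0, 0)) : IsDigitMin p s i j d := by
  have hp1 : 1 < p := by omega
  have hpow : p ^ s = p * p ^ (s - 1) := by
    rw [← pow_succ', Nat.sub_add_cancel hs]
  have hpos : 0 < p ^ (s - 1) := by positivity
  cases h with
  | case1 hi =>
    exact isDigitMin_two_mul (B := 1) (Nat.zero_le _)
      (fun t ht _ => two_le_digitProd hp1 (by omega)) (isLeast_digitProd_zero hp1)
  | case2 hi hj =>
    have lev : ∀ {x}, 0 < x → x ≤ p ^ (s - 1) →
        IsLeast (digitProd p '' {t | x ≤ t ∧ t < p ^ s}) 2 := fun hx hx' => by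
      simpa using ((inLevel_zero_zero hp hs).2 ⟨hx, hx'⟩).isLeast
    rcases Nat.eq_zero_or_pos i with rfl | hi0
    · have hj0 : 0 < j := Nat.pos_of_ne_zero fun h => h0 (by rw [h])
      simpa using (isDigitMin_of_isLeast (Nat.zero_le _) (lev hj0 hj)
        (isLeast_digitProd_zero hp1)).symm
    · rcases Nat.eq_zero_or_pos j with rfl | hj0
      · simpa using isDigitMin_of_isLeast (Nat.zero_le _) (lev hi0 hi)
          (isLeast_digitProd_zero hp1)
      · exact isDigitMin_of_same (lev hi0 hi) (lev hj0 hj)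
  | case3 hi hj =>
    have hj' := (inLevel_zero_zero hp hs).2 hj
    have hi' : InLevel p s 0 1 i :=
      ((inBeta_iff hs).1 (show InBeta p s 1 i from ⟨⟨le_rfl, by omega⟩, by omega, by omega⟩)).2
    simpa using isDigitMin_of_isLeast (lt_of_inLevel hi' hj' (by omega)).le hi'.isLeast hj'.isLeast
  | case4 hi hj =>
    have hj' := (inLevel_zero_zero hp hs).2 hj
    refine isDigitMin_two_mul (B := 2) (by omega) (fun t ht ht' => ?_) (by simpa using hj'.isLeast)
    have := le_digitProd hp1 0 (s - 1) 2 t (by rwa [add_zero, Nat.sub_add_cancel hs])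
      (by rw [add_zero, Nat.sub_add_cancel hs]; omega)
    simpa using this
  | @case5 i j β β' hββ hi hj =>
    have hi' := ((inBeta_iff hs).1 hi).2
    have hj' := ((inBeta_iff hs).1 hj).2
    rcases hββ.lt_or_eq with h | rfl
    · simpa using isDigitMin_of_isLeast (lt_of_inLevel hi' hj' (by omega)).le
        hi'.isLeast hj'.isLeast
    · have e : min (β' + 2) (2 * (β' + 2)) = β' + 2 := by omega
      rw [e]
      exact isDigitMin_of_same (by simpa using hi'.isLeast) (by simpa using hj'.isLeast)
  | @case6 i j k τ β hi hj =>
    obtain ⟨a, rfl, hk, hi'⟩ := hi.inLevel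
    have hj' := ((inBeta_iff hs).1 hj).2
    have hβ := hj.1
    refine isDigitMin_two_mul (lt_of_inLevel hi' hj' (by omega)).le (fun t ht ht' => ?_)
      (by simpa using hj'.isLeast)
    refine le_trans ?_ (hi'.isLeast.2 ⟨t, ⟨ht, ht'⟩, rfl⟩)
    have : p ≤ p ^ k := Nat.le_self_pow (by omega) p
    have h6 : 2 * p ^ k ≤ (a + 2) * p ^ k := Nat.mul_le_mul_right _ (by omega)
    omega
  | @case7 i j k τ hi hj =>
    obtain ⟨a, rfl, hk, hi'⟩ := hi.inLevel
    have hj' := ((inTau_iff hp1 hs).1 hj).2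
    exact isDigitMin_of_same hi'.isLeast hj'.isLeast
  | @case8 i j k τ₁ τ₂ hττ hi hj =>
    obtain ⟨a, rfl, hk, hi'⟩ := hi.inLevel
    obtain ⟨b, rfl, -, hj'⟩ := hj.inLevel
    have := isDigitMin_of_isLeast (lt_of_inLevel hi' hj' (by omega)).le hi'.isLeast hj'.isLeast
    rwa [min_comm, ← mul_assoc] at this
  | @case9 i j k' k'' τ₃ τ₄ hkk hi hj =>
    obtain ⟨a, rfl, hk, hi'⟩ := hi.inLevel
    obtain ⟨b, rfl, -, hj'⟩ := hj.inLevel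
    rw [mul_assoc]
    refine isDigitMin_two_mul (lt_of_inLevel hi' hj' (by omega)).le (fun t ht ht' => ?_)
      hj'.isLeast
    refine le_trans ?_ (hi'.isLeast.2 ⟨t, ⟨ht, ht'⟩, rfl⟩)
    have h3 : p ^ k'' * p ≤ p ^ k' := by
      rw [← pow_succ]
      exact Nat.pow_le_pow_right (by omega) hkk
    have hb : b + 2 ≤ p := by have := hj.1; omega
    calc 2 * ((b + 1 + 1) * p ^ k'') ≤ 2 * (p * p ^ k'') := by gcongr
      _ = 2 * (p ^ k'' * p) := by ring
      _ ≤ 2 * p ^ k' := by gcongr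
      _ ≤ _ := by gcongr; omega
  | @case10 j β hj =>
    have hj' := ((inBeta_iff hs).1 hj).2
    have hjs : j ≤ p ^ s := by
      rw [hpow]
      exact hj.2.2.trans (Nat.mul_le_mul_right _ (by have := hj.1; omega))
    exact isDigitMin_two_mul hjs (fun t ht ht' => absurd ht (by omega))
      (by simpa using hj'.isLeast)
  | @case11 j k τ hj =>
    obtain ⟨b, rfl, -, hj'⟩ := hj.inLevel
    rw [mul_assoc]
    obtain ⟨t, ⟨ht1, ht2⟩, -⟩ := hj'.isLeast.1
    exact isDigitMin_two_mul (by omega) (fun t ht ht' => absurd ht (by omega)) hj'.isLeast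

lemma exists_table {p s i j : ℕ} (hp : 2 < p) (hs : 0 < s) (hi : i ≤ p ^ s) (hj : j ≤ p ^ s)
    (h0 : (i, j) ≠ (0, 0)) (h1 : (i, j) ≠ (p ^ s, p ^ s)) : ∃ d, Table p s i j d := by
  have hp1 : 1 < p := by omega
  have hpow : p ^ s = p * p ^ (s - 1) := by
    rw [← pow_succ', Nat.sub_add_cancel hs]
  have hpos : 0 < p ^ (s - 1) := by positivity
  have h2p : 2 * p ^ (s - 1) < p ^ s := by
    rw [hpow]; exact Nat.mul_lt_mul_of_pos_right hp hpos
  -- It suffices to treat pairs with `j ≤ i`, since the table is symmetric.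
  wlog hji : j ≤ i generalizing i j
  · obtain ⟨d, hd⟩ := this hj hi (fun h => h0 (by simp_all)) (fun h => h1 (by simp_all))
      (by omega)
    exact ⟨d, hd.symm⟩
  suffices h : ∃ d, Row p s i j d ∨ Row p s j i d from h
  have hlt : j < p ^ s := by
    rcases hj.lt_or_eq with h | rfl
    · exact h
    · exact absurd (by rw [le_antisymm hi hji]) h1
  rcases Nat.eq_zero_or_pos j with rfl | hj0
  · exact ⟨_, Or.inl (.case1 ⟨Nat.pos_of_ne_zero fun h => h0 (by rw [h]), hi⟩)⟩
  rcases le_or_gt j (p ^ (s - 1)) with hjs | hjs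
  · rcases le_or_gt i (p ^ (s - 1)) with his | his
    · exact ⟨_, Or.inl (.case2 his hjs)⟩
    rcases le_or_gt i (2 * p ^ (s - 1)) with his' | his'
    · exact ⟨_, Or.inl (.case3 ⟨his, his'⟩ ⟨hj0, hjs⟩)⟩
    · exact ⟨_, Or.inl (.case4 ⟨his', hi⟩ ⟨hj0, hjs⟩)⟩
  -- Above `p ^ (s - 1)` every level is one of the ranges `B_β` and `T_{k,τ}`.
  have split : ∀ x, p ^ (s - 1) < x → x < p ^ s →
      (∃ β, InBeta p s β x) ∨ ∃ k τ, InTau p s k τ x := fun x hx hx' => by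
    obtain ⟨k, a, h⟩ := exists_inLevel hp1 s x (by omega) hx'
    rcases Nat.eq_zero_or_pos k with rfl | hk
    · rcases Nat.eq_zero_or_pos a with rfl | ha
      · exact absurd ((inLevel_zero_zero hp hs).1 h).2 (by omega)
      · exact Or.inl ⟨a, (inBeta_iff hs).2 ⟨ha, h⟩⟩
    · exact Or.inr ⟨k, a + 1, (inTau_iff hp1 hs).2 ⟨hk, h⟩⟩
  rcases split j hjs hlt with ⟨β, hβ⟩ | ⟨k, τ, hτ⟩
  · rcases hi.lt_or_eq with hi | rfl
    · rcases split i (by omega) hi with ⟨β', hβ'⟩ | ⟨k, τ, hτ⟩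
      · rcases le_total β β' with h | h
        · exact ⟨_, Or.inl (.case5 h hβ' hβ)⟩
        · exact ⟨_, Or.inr (.case5 h hβ hβ')⟩
      · exact ⟨_, Or.inl (.case6 hτ hβ)⟩
    · exact ⟨_, Or.inl (.case10 hβ)⟩
  · rcases hi.lt_or_eq with hi | rfl
    · rcases split i (by omega) hi with ⟨β', hβ'⟩ | ⟨k', τ', hτ'⟩
      · exact ⟨_, Or.inr (.case6 hτ hβ')⟩
      · rcases lt_trichotomy k k' with h | rfl | h
        · exact ⟨_, Or.inl (.case9 h hτ' hτ)⟩
        · rcases lt_trichotomy τ τ' with h | rfl | h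
          · exact ⟨_, Or.inl (.case8 h hτ' hτ)⟩
          · exact ⟨_, Or.inl (.case7 hτ' hτ)⟩
          · exact ⟨_, Or.inr (.case8 h hτ hτ')⟩
        · exact ⟨_, Or.inr (.case9 h hτ hτ')⟩
    · exact ⟨_, Or.inl (.case11 hτ)⟩

end Constacyclic

/-! ### Decimation of polynomials -/

section Decimation

variable {F : Type*} [Field F]

/-- The polynomial `f_r` in the decomposition `f = ∑_{r < m} X ^ r * f_r (X ^ m)`: its `k`-th
coefficient is the coefficient of `f` at `m * k + r`. -/
noncomputable def decimate (m r : ℕ) (f : F[X]) : F[X] :=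
  ∑ k ∈ Finset.range (f.natDegree + 1), C (f.coeff (m * k + r)) * X ^ k

lemma coeff_decimate {m : ℕ} (hm : 0 < m) (r : ℕ) (f : F[X]) (k : ℕ) :
    (decimate m r f).coeff k = f.coeff (m * k + r) := by
  simp only [decimate, finsetSum_coeff, coeff_C_mul_X_pow]
  rw [Finset.sum_ite_eq, ite_eq_left_iff]
  intro h
  rw [Finset.mem_range, not_lt] at h
  refine (coeff_eq_zero_of_natDegree_lt ?_).symm
  nlinarith

lemma decimate_add {m : ℕ} (hm : 0 < m) (r : ℕ) (f g : F[X]) :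
    decimate m r (f + g) = decimate m r f + decimate m r g := by
  ext k
  simp [coeff_decimate hm]

lemma decimate_expand_mul {m r : ℕ} (hr : r < m) (u f : F[X]) :
    decimate m r (expand F m u * f) = u * decimate m r f := by
  have hm : 0 < m := by omega
  induction u using Polynomial.induction_on' with
  | add u v hu hv => rw [map_add, add_mul, decimate_add hm, hu, hv, add_mul]
  | monomial e a =>
    ext k
    rw [expand_monomial, ← C_mul_X_pow_eq_monomial, ← C_mul_X_pow_eq_monomial, coeff_decimate hm,
      mul_assoc, mul_assoc, coeff_C_mul, coeff_C_mul, coeff_X_pow_mul', coeff_X_pow_mul',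
      coeff_decimate hm]
    by_cases h : e ≤ k
    · obtain ⟨l, rfl⟩ := Nat.exists_eq_add_of_le h
      rw [if_pos (by nlinarith), if_pos h]
      congr 2
      rw [Nat.add_sub_cancel_left]
      have : m * (e + l) + r = m * l + r + e * m := by ring
      omega
    · rw [if_neg, if_neg h]
      have : m * (k + 1) ≤ m * e := Nat.mul_le_mul_left _ (by omega)
      have e1 : e * m = m * e := mul_comm _ _
      rw [mul_add] at this
      omega

lemma sum_decimate {m : ℕ} (hm : 0 < m) (f : F[X]) :
    ∑ r ∈ Finset.range m, X ^ r * expand F m (decimate m r f) = f := by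
  ext k
  have key : ∀ r ∈ Finset.range m,
      (X ^ r * expand F m (decimate m r f)).coeff k = if k % m = r then f.coeff k else 0 := by
    intro r hr
    rw [Finset.mem_range] at hr
    rw [coeff_X_pow_mul', coeff_expand hm, coeff_decimate hm]
    have hdm := Nat.div_add_mod k m
    by_cases h : k % m = r
    · subst h
      have e : k - k % m = m * (k / m) := by omega
      rw [if_pos (Nat.mod_le _ _), e, if_pos (Dvd.intro _ rfl), Nat.mul_div_cancel_left _ hm, hdm,
        if_pos rfl]
    · rw [if_neg h]
      split_ifs with h1 h2
      · exfalso
        obtain ⟨q, hq⟩ := h2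
        apply h
        rw [show k = r + m * q by omega, Nat.add_mul_mod_self_left, Nat.mod_eq_of_lt hr]
      · rfl
      · rfl
  rw [finsetSum_coeff, Finset.sum_congr rfl key, Finset.sum_ite_eq,
    if_pos (Finset.mem_range.2 (Nat.mod_lt _ hm))]

lemma card_support_eq_sum_decimate {m : ℕ} (hm : 0 < m) (f : F[X]) :
    f.support.card = ∑ r ∈ Finset.range m, (decimate m r f).support.card := by
  rw [Finset.card_eq_sum_card_fiberwise (f := (· % m)) (t := Finset.range m)
    (fun k _ => by simpa using Nat.mod_lt k hm)]
  refine Finset.sum_congr rfl fun r hr => ?_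
  rw [Finset.mem_range] at hr
  rw [← Finset.card_image_of_injective (decimate m r f).support
    (f := fun k => m * k + r) (fun x y h => by simpa [hm.ne'] using h)]
  congr 1
  ext k
  simp only [Finset.mem_filter, Finset.mem_image, mem_support_iff, coeff_decimate hm]
  constructor
  · rintro ⟨h, rfl⟩
    exact ⟨k / m, by rwa [Nat.div_add_mod], Nat.div_add_mod k m⟩
  · rintro ⟨l, h, rfl⟩
    exact ⟨h, by rw [Nat.mul_add_mod, Nat.mod_eq_of_lt hr]⟩

/-- The remainder of `f` modulo `X ^ m - b`. -/
noncomputable def reduceMod (m : ℕ) (b : F) (f : F[X]) : F[X] :=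
  ∑ r ∈ Finset.range m, C ((decimate m r f).eval b) * X ^ r

lemma coeff_reduceMod (m : ℕ) (b : F) (f : F[X]) (k : ℕ) :
    (reduceMod m b f).coeff k = if k < m then (decimate m k f).eval b else 0 := by
  simp only [reduceMod, finsetSum_coeff, coeff_C_mul_X_pow]
  rw [Finset.sum_ite_eq]
  simp

lemma dvd_sub_reduceMod {m : ℕ} (hm : 0 < m) (b : F) (f : F[X]) :
    X ^ m - C b ∣ f - reduceMod m b f := by
  nth_rw 1 [← sum_decimate hm f]
  rw [reduceMod, ← Finset.sum_sub_distrib]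
  refine Finset.dvd_sum fun r _ => ?_
  rw [mul_comm (C _), ← mul_sub]
  refine Dvd.dvd.mul_left ?_ _
  have h := (expand F m).toRingHom.map_dvd (X_sub_C_dvd_sub_C_eval (p := decimate m r f) (a := b))
  simpa using h

lemma dvd_reduceMod {m : ℕ} (hm : 0 < m) {b : F} {d f : F[X]} (hd : d ∣ X ^ m - C b)
    (hf : d ∣ f) : d ∣ reduceMod m b f := by
  have := dvd_sub hf (hd.trans (dvd_sub_reduceMod hm b f))
  rwa [sub_sub_cancel] at this

lemma reduceMod_ne_zero {m : ℕ} (hm : 0 < m) {b : F} {f : F[X]} (h : ¬ X ^ m - C b ∣ f) :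
    reduceMod m b f ≠ 0 := fun h0 => h (by simpa [h0] using dvd_sub_reduceMod hm b f)

/-- A bound for `(X - b) ^ t * u` gives one for `(X ^ m - b) ^ t * v`, by decimation. -/
lemma mul_card_support_reduceMod_le {m : ℕ} (hm : 0 < m) {b : F} {t M : ℕ}
    (hM : ∀ u : F[X], u.eval b ≠ 0 → M ≤ ((X - C b) ^ t * u).support.card) (v : F[X]) :
    M * (reduceMod m b v).support.card ≤ ((X ^ m - C b) ^ t * v).support.card := by
  classical
  have e : (X ^ m - C b : F[X]) ^ t = expand F m ((X - C b) ^ t) := by simp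
  have hs : (reduceMod m b v).support
      = (Finset.range m).filter fun r => (decimate m r v).eval b ≠ 0 := by
    ext k
    simp [coeff_reduceMod]
  rw [card_support_eq_sum_decimate hm (_ * v), hs, mul_comm, ← smul_eq_mul]
  refine (Finset.card_nsmul_le_sum _ _ _ fun r hr => ?_).trans
    (Finset.sum_le_sum_of_subset (Finset.filter_subset _ _))
  rw [Finset.mem_filter, Finset.mem_range] at hr
  rw [e, decimate_expand_mul hr.1]
  exact hM _ hr.2

/-! ### Weights of multiples of powers of binomials -/

lemma card_support_X_mul (f : F[X]) : (X * f).support.card = f.support.card := by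
  rw [← Finset.card_image_of_injective f.support Nat.succ_injective]
  congr 1
  ext k
  cases k <;> simp [coeff_X_mul]

/-- In degree below the characteristic, a nonzero root of multiplicity `t` forces `t + 1` nonzero
coefficients, as over the reals: differentiate and divide by powers of `X`. -/
lemma lt_card_support_of_natDegree_lt {p : ℕ} [CharP F p] {a : F} (ha : a ≠ 0) (t : ℕ) (h : F[X])
    (h0 : h ≠ 0) (hdeg : h.natDegree < p) (hdvd : (X - C a) ^ t ∣ h) : t < h.support.card := by
  induction hd : h.natDegree using Nat.strong_induction_on generalizing h t with
  | _ d ih =>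
    by_cases hc : h.coeff 0 = 0
    · obtain ⟨u, rfl⟩ := X_dvd_iff.2 hc
      have hu : u ≠ 0 := right_ne_zero_of_mul h0
      have hX : IsCoprime (X - C a) (X : F[X]) := by
        simpa using isCoprime_X_sub_C_of_isUnit_sub (a := a) (b := 0) (by simpa using ha)
      rw [natDegree_X_mul hu] at hd hdeg
      rw [card_support_X_mul]
      exact ih _ (by omega) t u hu (by omega) (hX.pow_left.dvd_of_dvd_mul_left hdvd) rfl
    · cases t with
      | zero => exact Finset.card_pos.2 (nonempty_support_iff.2 h0)
      | succ t =>
        have hdvd' : (X - C a) ^ t ∣ derivative h := by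
          simpa using pow_sub_one_dvd_derivative_of_pow_dvd hdvd
        have hpos : 0 < h.natDegree := by
          have := natDegree_le_of_dvd hdvd h0
          rw [natDegree_pow, natDegree_X_sub_C] at this
          omega
        -- The leading coefficient survives differentiation, as `0 < h.natDegree < p`.
        have hder : derivative h ≠ 0 := by
          intro hz
          have := congrArg (fun q => coeff q (h.natDegree - 1)) hz
          simp only [coeff_derivative, coeff_zero] at this
          rw [Nat.sub_add_cancel hpos] at this
          rcases mul_eq_zero.1 this with h1 | h1
          · exact h0 (leadingCoeff_eq_zero.1 h1)
          · have h2 : ((h.natDegree : ℕ) : F) = 0 := by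
              rw [← h1, Nat.cast_sub hpos]; simp
            rw [CharP.cast_eq_zero_iff F p] at h2
            exact absurd (Nat.le_of_dvd hpos h2) (by omega)
        have hlt := natDegree_derivative_lt hpos.ne'
        -- The constant term is lost.
        have hsub : (derivative h).support.card < h.support.card := by
          have hinj : ((derivative h).support.image Nat.succ).card = (derivative h).support.card :=
            Finset.card_image_of_injective _ Nat.succ_injective
          rw [← hinj]
          refine Finset.card_lt_card ⟨fun k hk => ?_, fun hs => ?_⟩
          · obtain ⟨l, hl, rfl⟩ := Finset.mem_image.1 hk
            rw [mem_support_iff, coeff_derivative] at hl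
            exact mem_support_iff.2 (left_ne_zero_of_mul hl)
          · obtain ⟨l, -, hl⟩ := Finset.mem_image.1 (hs (mem_support_iff.2 hc))
            exact Nat.succ_ne_zero l hl
        exact Nat.succ_le_of_lt (ih _ (by omega) t _ hder (by omega) hdvd' rfl) |>.trans_lt hsub

/-- A nonzero root of multiplicity `t` forces at least `digitProd p t` nonzero coefficients. -/
lemma digitProd_le_card_support {p : ℕ} [CharP F p] (hp : p.Prime) (t : ℕ) {a : F} (ha : a ≠ 0)
    {v : F[X]} (hv : v.eval a ≠ 0) : digitProd p t ≤ ((X - C a) ^ t * v).support.card := by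
  have : Fact p.Prime := ⟨hp⟩
  induction t using Nat.strong_induction_on generalizing a v with
  | _ t ih =>
    rcases Nat.eq_zero_or_pos t with rfl | ht
    · rw [digitProd_zero, pow_zero, one_mul]
      exact Finset.card_pos.2 (nonempty_support_iff.2 fun h => hv (by simp [h]))
    have hr : t % p < p := Nat.mod_lt _ hp.pos
    have hpow : (X - C a : F[X]) ^ p = X ^ p - C (a ^ p) := by
      rw [sub_pow_char, C_pow]
    have e : digitProd p t = digitProd p (t / p) * (t % p + 1) := by
      rw [mul_comm, ← digitProd_mul_add hp.one_lt _ hr, Nat.div_add_mod]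
    have e' : (X - C a) ^ t * v = (X ^ p - C (a ^ p)) ^ (t / p) * ((X - C a) ^ (t % p) * v) := by
      rw [← hpow, ← pow_mul, ← mul_assoc, ← pow_add, Nat.div_add_mod]
    -- The remainder modulo `(X - a) ^ p` keeps the divisibility by `(X - a) ^ (t % p)`.
    have hne : ¬ X ^ p - C (a ^ p) ∣ (X - C a) ^ (t % p) * v := by
      rw [← hpow]
      intro h
      have h1 : (X - C a) ^ (t % p) * (X - C a) ∣ (X - C a) ^ (t % p) * v := by
        rw [← pow_succ]
        exact (pow_dvd_pow _ hr).trans h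
      rw [mul_dvd_mul_iff_left (pow_ne_zero _ (X_sub_C_ne_zero a)), dvd_iff_isRoot] at h1
      exact hv h1
    have hdvd : (X - C a) ^ (t % p) ∣ reduceMod p (a ^ p) ((X - C a) ^ (t % p) * v) :=
      dvd_reduceMod hp.pos (by rw [← hpow]; exact pow_dvd_pow _ hr.le) (dvd_mul_right _ _)
    have hdeg : (reduceMod p (a ^ p) ((X - C a) ^ (t % p) * v)).natDegree < p := by
      refine lt_of_le_of_lt (natDegree_le_iff_coeff_eq_zero.2 fun k hk => ?_)
        (Nat.sub_lt hp.pos one_pos)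
      rw [coeff_reduceMod, if_neg (by omega)]
    have hlt := lt_card_support_of_natDegree_lt ha _ _ (reduceMod_ne_zero hp.pos hne) hdeg hdvd
    rw [e, e']
    refine (Nat.mul_le_mul_left _ hlt).trans ?_
    exact mul_card_support_reduceMod_le hp.pos
      (fun u hu => ih _ (Nat.div_lt_self ht hp.one_lt) (pow_ne_zero _ ha) hu) _

lemma card_support_expand_le {m : ℕ} (f : F[X]) :
    (expand F m f).support.card ≤ f.support.card := by
  rw [expand_eq_sum, Polynomial.sum]
  have : ∀ s : Finset ℕ, (∑ e ∈ s, C (f.coeff e) * (X ^ m) ^ e).support.card ≤ s.card := by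
    intro s
    induction s using Finset.induction_on with
    | empty => simp
    | insert k s hk ih =>
      rw [Finset.sum_insert hk, Finset.card_insert_of_notMem hk, ← pow_mul]
      refine (Finset.card_le_card support_add).trans ((Finset.card_union_le _ _).trans ?_)
      have := card_support_C_mul_X_pow_le_one (c := f.coeff k) (n := m * k)
      omega
  exact this _

lemma card_support_X_sub_C_pow_le {p : ℕ} [CharP F p] (hp : p.Prime) (t : ℕ) (a : F) :
    ((X - C a) ^ t).support.card ≤ digitProd p t := by
  have : Fact p.Prime := ⟨hp⟩
  induction t using Nat.strong_induction_on generalizing a with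
  | _ t ih =>
    rcases Nat.eq_zero_or_pos t with rfl | ht
    · simpa using Polynomial.card_support_C_mul_X_pow_le_one (c := (1 : F)) (n := 0)
    have hr : t % p < p := Nat.mod_lt _ hp.pos
    have e : digitProd p t = digitProd p (t / p) * (t % p + 1) := by
      rw [mul_comm, ← digitProd_mul_add hp.one_lt _ hr, Nat.div_add_mod]
    have e' : (X - C a) ^ t = expand F p ((X - C (a ^ p)) ^ (t / p)) * (X - C a) ^ (t % p) := by
      conv_lhs => rw [← Nat.div_add_mod t p, pow_add, pow_mul, sub_pow_char]
      simp
    rw [e, e']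
    refine card_support_mul_le.trans (Nat.mul_le_mul ?_ ?_)
    · exact (card_support_expand_le _).trans (ih _ (Nat.div_lt_self ht hp.one_lt) _)
    · refine (card_supp_le_succ_natDegree _).trans ?_
      simp

lemma card_support_X_pow_sub_C_pow_le {p : ℕ} [CharP F p] (hp : p.Prime) (m t : ℕ) (a : F) :
    ((X ^ m - C a) ^ t).support.card ≤ digitProd p t := by
  have e : (X ^ m - C a : F[X]) ^ t = expand F m ((X - C a) ^ t) := by simp
  rw [e]
  exact (card_support_expand_le _).trans (card_support_X_sub_C_pow_le hp t a)

/-- A nonzero polynomial with one term is a unit times a power of `X`, which has no other irreducible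
factor than `X`. -/
lemma two_le_card_support_of_dvd {f h : F[X]} (hf : Irreducible f) (hf0 : f.coeff 0 ≠ 0)
    (h0 : h ≠ 0) (hdvd : f ∣ h) : 2 ≤ h.support.card := by
  by_contra! hlt
  obtain ⟨k, c, rfl⟩ := card_support_le_one_iff_monomial.1 (Nat.lt_succ_iff.1 hlt)
  have hc : c ≠ 0 := fun hc => h0 (by simp [hc])
  rw [← C_mul_X_pow_eq_monomial] at hdvd
  rcases hf.prime.dvd_or_dvd hdvd with h1 | h1
  · exact hf.not_isUnit (isUnit_of_dvd_unit h1 (isUnit_C.2 hc.isUnit))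
  · have h2 := hf.dvd_symm irreducible_X (hf.prime.dvd_of_dvd_pow h1)
    exact hf0 (X_dvd_iff.1 h2)

end Decimation

namespace Constacyclic

/-! ### Words and polynomials -/

section Words

variable {F : Type*} [Field F] {N : ℕ}

lemma coeff_wordPoly (c : Fin N → F) (k : ℕ) :
    (wordPoly c).coeff k = if h : k < N then c ⟨k, h⟩ else 0 := by
  simp only [wordPoly, finsetSum_coeff, coeff_C_mul_X_pow]
  split_ifs with h
  · rw [Finset.sum_eq_single ⟨k, h⟩]
    · simp
    · intro b _ hb
      exact if_neg fun hk => hb (Fin.ext hk.symm)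
    · simp
  · exact Finset.sum_eq_zero fun i _ => if_neg fun hk => h (by omega)

lemma degree_wordPoly_lt (c : Fin N → F) : (wordPoly c).degree < N := by
  rw [degree_lt_iff_coeff_zero]
  intro k hk
  rw [coeff_wordPoly, dif_neg (by omega)]

lemma wordPoly_coeff {q : F[X]} (hq : q.degree < N) :
    wordPoly (fun i : Fin N => q.coeff i) = q := by
  ext k
  rw [coeff_wordPoly]
  split_ifs with h
  · rfl
  · exact ((degree_lt_iff_coeff_zero _ _).1 hq k (by omega)).symm

lemma wordPoly_injective : Function.Injective (wordPoly : (Fin N → F) → F[X]) := by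
  intro c d h
  ext i
  have := congrArg (fun q => q.coeff i) h
  simpa [coeff_wordPoly] using this

lemma wordPoly_sub (c d : Fin N → F) : wordPoly (c - d) = wordPoly c - wordPoly d := by
  ext k
  rw [coeff_sub]
  simp only [coeff_wordPoly]
  split_ifs <;> simp

@[simp] lemma wordPoly_zero : wordPoly (0 : Fin N → F) = 0 := by
  ext k
  simp [coeff_wordPoly]

lemma hammingNorm_eq_card_support [DecidableEq F] (c : Fin N → F) :
    hammingNorm c = (wordPoly c).support.card := by
  rw [hammingNorm, ← Finset.card_image_of_injective _ Fin.val_injective]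
  congr 1
  ext k
  simp only [Finset.mem_image, Finset.mem_filter, Finset.mem_univ, true_and, mem_support_iff,
    coeff_wordPoly]
  constructor
  · rintro ⟨i, hi, rfl⟩
    simpa using hi
  · intro h
    by_cases hk : k < N
    · exact ⟨⟨k, hk⟩, by simpa [hk] using h, rfl⟩
    · simp [hk] at h

lemma X_mul_wordPoly (hN : 0 < N) (lam : F) (c : Fin N → F) :
    X * wordPoly c = wordPoly (shift lam c) + C (c ⟨N - 1, by omega⟩) * (X ^ N - C lam) := by
  ext k
  rw [coeff_add, coeff_C_mul, coeff_sub, coeff_X_pow, coeff_C, coeff_wordPoly]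
  cases k with
  | zero => simp [hN, shift, hN.ne, mul_comm]
  | succ k =>
    rw [coeff_X_mul, coeff_wordPoly]
    rcases lt_trichotomy (k + 1) N with h | h | h
    · simp [h, shift, h.ne, show k < N by omega]
    · subst h
      simp
    · rw [dif_neg (by omega), dif_neg (by omega), if_neg (by omega)]
      simp

lemma mk_eq_mk_iff {lam : F} {a b : F[X]} :
    (Ideal.Quotient.mk _ a : QuotRing N lam) = Ideal.Quotient.mk _ b ↔ X ^ N - C lam ∣ a - b := by
  rw [Ideal.Quotient.eq, Ideal.mem_span_singleton]

lemma wordClass_apply (lam : F) (c : Fin N → F) :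
    wordClass N lam c = Ideal.Quotient.mk _ (wordPoly c) := rfl

lemma mem_codeOfIdeal {lam : F} {I : Ideal (QuotRing N lam)} {c : Fin N → F} :
    c ∈ codeOfIdeal I ↔ (Ideal.Quotient.mk _ (wordPoly c) : QuotRing N lam) ∈ I := Iff.rfl

lemma mk_wordPoly_shift (hN : 0 < N) (lam : F) (c : Fin N → F) :
    (Ideal.Quotient.mk _ (wordPoly (shift lam c)) : QuotRing N lam)
      = Ideal.Quotient.mk _ (X * wordPoly c) := by
  rw [mk_eq_mk_iff, X_mul_wordPoly hN lam c, sub_add_cancel_left, dvd_neg]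
  exact dvd_mul_left _ _

lemma isConstacyclic_codeOfIdeal (hN : 0 < N) {lam : F} (I : Ideal (QuotRing N lam)) :
    IsConstacyclic lam (codeOfIdeal I) := by
  intro c hc
  rw [mem_codeOfIdeal, mk_wordPoly_shift hN, map_mul]
  exact I.mul_mem_left _ hc

lemma mk_mem_span_mk_iff {lam : F} {G w : F[X]} (hG : G ∣ X ^ N - C lam) :
    (Ideal.Quotient.mk _ w : QuotRing N lam) ∈ Ideal.span {Ideal.Quotient.mk _ G} ↔ G ∣ w := by
  rw [Ideal.mem_span_singleton]
  constructor
  · rintro ⟨q, hq⟩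
    obtain ⟨q, rfl⟩ := Ideal.Quotient.mk_surjective q
    rw [← map_mul, mk_eq_mk_iff] at hq
    have := dvd_add (hG.trans hq) (dvd_mul_right G q)
    rwa [sub_add_cancel] at this
  · exact fun h => (Ideal.Quotient.mk _).map_dvd h

/-- A constacyclic code consists of the words whose polynomial is divisible by a fixed divisor of
`X ^ N - lam`, since `F[X]` is a principal ideal ring. -/
lemma IsConstacyclic.exists_dvd (hN : 0 < N) {lam : F} {D : Submodule F (Fin N → F)}
    (hD : IsConstacyclic lam D) : ∃ h : F[X], h ∣ X ^ N - C lam ∧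
      ∀ c, c ∈ D ↔ h ∣ wordPoly c := by
  have mem_X : ∀ q : F[X], (∃ c ∈ D, wordClass N lam c = Ideal.Quotient.mk _ q) →
      ∃ c ∈ D, wordClass N lam c = Ideal.Quotient.mk _ (X * q) := by
    rintro q ⟨c, hc, h⟩
    refine ⟨shift lam c, hD c hc, ?_⟩
    rw [wordClass_apply, mk_wordPoly_shift hN, map_mul, map_mul, ← h, wordClass_apply]
  have mem_C : ∀ (a : F) (q : F[X]), (∃ c ∈ D, wordClass N lam c = Ideal.Quotient.mk _ q) →
      ∃ c ∈ D, wordClass N lam c = Ideal.Quotient.mk _ (C a * q) := by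
    rintro a q ⟨c, hc, h⟩
    refine ⟨a • c, D.smul_mem a hc, ?_⟩
    rw [map_smul, h, ← smul_eq_C_mul]
    rfl
  have mem_add : ∀ q r : F[X], (∃ c ∈ D, wordClass N lam c = Ideal.Quotient.mk _ q) →
      (∃ c ∈ D, wordClass N lam c = Ideal.Quotient.mk _ r) →
      ∃ c ∈ D, wordClass N lam c = Ideal.Quotient.mk _ (q + r) := by
    rintro q r ⟨c, hc, h⟩ ⟨d, hd, h'⟩
    exact ⟨c + d, D.add_mem hc hd, by rw [map_add, h, h', map_add]⟩
  let J : Ideal F[X] :=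
    { carrier := {q | ∃ c ∈ D, wordClass N lam c = Ideal.Quotient.mk _ q}
      add_mem' := fun {q r} hq hr => mem_add q r hq hr
      zero_mem' := ⟨0, D.zero_mem, by simp⟩
      smul_mem' := by
        intro a q hq
        rw [smul_eq_mul]
        induction a using Polynomial.induction_on' with
        | add a b ha hb => rw [add_mul]; exact mem_add _ _ ha hb
        | monomial k a =>
          rw [← C_mul_X_pow_eq_monomial, mul_assoc]
          refine mem_C _ _ ?_
          induction k with
          | zero => simpa using hq
          | succ k ih => rw [pow_succ', mul_assoc]; exact mem_X _ ih }
  obtain ⟨h, hJ⟩ := (IsPrincipalIdealRing.principal J).principal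
  have hdvd : ∀ q, h ∣ q ↔ ∃ c ∈ D, wordClass N lam c = Ideal.Quotient.mk _ q := by
    intro q
    rw [← Ideal.mem_span_singleton]
    change q ∈ Submodule.span F[X] {h} ↔ q ∈ J
    rw [← hJ]
  refine ⟨h, (hdvd _).2 ⟨0, D.zero_mem, ?_⟩, fun c => ?_⟩
  · rw [map_zero, eq_comm, Ideal.Quotient.eq_zero_iff_mem]
    exact Ideal.mem_span_singleton_self _
  · rw [hdvd]
    refine ⟨fun hc => ⟨c, hc, rfl⟩, ?_⟩
    rintro ⟨d, hd, hdc⟩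
    rw [wordClass_apply, mk_eq_mk_iff] at hdc
    have hdeg : (wordPoly d - wordPoly c).degree < (X ^ N - C lam).degree := by
      rw [degree_X_pow_sub_C hN]
      exact (degree_sub_le _ _).trans_lt
        (max_lt (degree_wordPoly_lt d) (degree_wordPoly_lt c))
    have := wordPoly_injective (sub_eq_zero.1 (eq_zero_of_dvd_of_degree_lt hdc hdeg))
    rwa [← this]

end Words

/-! ### Weights in the codes `⟨f ^ i * g ^ j⟩` -/

section Weights

variable {F : Type*} [Field F] {p s n : ℕ} {ψ a b : F}

lemma coeff_zero_X_pow_sub_C (hn : 0 < n) (ha : a ≠ 0) : (X ^ n - C a).coeff 0 ≠ 0 := by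
  simpa [coeff_X_pow, hn.ne] using ha

lemma degree_X_pow_sub_C_mul_pow (hn : 0 < n) (t u : ℕ) :
    ((X ^ n - C a) ^ t * (X ^ n - C b) ^ u).degree = ((n * t + n * u : ℕ) : WithBot ℕ) := by
  rw [degree_mul, degree_pow, degree_pow, degree_X_pow_sub_C hn, degree_X_pow_sub_C hn]
  simp [mul_comm]

/-- With `t` maximal such that `(f * g) ^ t` divides `w`, the weight of `w` is at least
`digitProd p t` times the weight of `w / (f * g) ^ t` modulo `f * g = X ^ (2 * n) - ψ`; this
remainder has at least two terms when it is divisible by `f` or by `g`. -/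
lemma le_card_support [CharP F p] (hp : p.Prime) (hn : 0 < n) (hψ : ψ ≠ 0) (ha : a ≠ 0)
    (hb : b ≠ 0) (hab : a ≠ b) (hfac : (X ^ (2 * n) - C ψ : F[X]) = (X ^ n - C a) * (X ^ n - C b))
    (hf : Irreducible (X ^ n - C a : F[X])) (hg : Irreducible (X ^ n - C b : F[X]))
    {i j d : ℕ} (hd : IsDigitMin p s i j d) {w : F[X]} (hw : w ≠ 0)
    (hdeg : w.degree < ((2 * n * p ^ s : ℕ) : WithBot ℕ))
    (hdvd : (X ^ n - C a) ^ i * (X ^ n - C b) ^ j ∣ w) : d ≤ w.support.card := by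
  have h2n : 0 < 2 * n := by omega
  have hcop : IsCoprime (X ^ n - C a : F[X]) (X ^ n - C b) := by
    have := (isCoprime_X_sub_C_of_isUnit_sub (sub_ne_zero.2 hab).isUnit).map
      (expand F n).toRingHom
    simpa using this
  have hfin : FiniteMultiplicity (X ^ (2 * n) - C ψ) w :=
    finiteMultiplicity_of_degree_pos_of_monic
      (by rw [degree_X_pow_sub_C h2n]; exact_mod_cast h2n) (monic_X_pow_sub_C _ h2n.ne') hw
  obtain ⟨v, hv, hnd⟩ := hfin.exists_eq_pow_mul_and_not_dvd
  generalize multiplicity (X ^ (2 * n) - C ψ) w = t at hv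
  have hts : t < p ^ s := by
    have h1 := (degree_le_of_dvd (Dvd.intro _ hv.symm) hw).trans_lt hdeg
    rw [degree_pow, degree_X_pow_sub_C h2n] at h1
    have h2 : t * (2 * n) < 2 * n * p ^ s := by
      rw [nsmul_eq_mul] at h1
      exact_mod_cast h1
    rw [mul_comm] at h2
    exact lt_of_mul_lt_mul_left' h2
  have hwt : digitProd p t * (reduceMod (2 * n) ψ v).support.card ≤ w.support.card := by
    rw [hv]
    exact mul_card_support_reduceMod_le h2n (fun u hu => digitProd_le_card_support hp t hψ hu) v
  have hne := reduceMod_ne_zero h2n hnd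
  have hv' : w = (X ^ n - C a) ^ t * ((X ^ n - C b) ^ t * v) := by
    rw [hv, hfac, mul_pow, mul_assoc]
  have hfv : t < i → X ^ n - C a ∣ v := by
    intro h
    have h1 : (X ^ n - C a) ^ t * (X ^ n - C a) ∣ (X ^ n - C a) ^ t * ((X ^ n - C b) ^ t * v) := by
      rw [← pow_succ, ← hv']
      exact (pow_dvd_pow _ h).trans ((dvd_mul_right _ _).trans hdvd)
    rw [mul_dvd_mul_iff_left (pow_ne_zero _ hf.ne_zero)] at h1
    exact hcop.pow_right.dvd_of_dvd_mul_left h1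
  have hgv : t < j → X ^ n - C b ∣ v := by
    intro h
    have h1 : (X ^ n - C b) ^ t * (X ^ n - C b) ∣ (X ^ n - C b) ^ t * ((X ^ n - C a) ^ t * v) := by
      rw [← pow_succ, mul_left_comm, ← hv']
      exact (pow_dvd_pow _ h).trans ((dvd_mul_left _ _).trans hdvd)
    rw [mul_dvd_mul_iff_left (pow_ne_zero _ hg.ne_zero)] at h1
    exact hcop.symm.pow_right.dvd_of_dvd_mul_left h1
  have hmin : min i j ≤ t := by
    by_contra! h
    rw [lt_min_iff] at h
    exact hnd (hfac ▸ hcop.mul_dvd (hfv h.1) (hgv h.2))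
  rcases le_or_gt (max i j) t with hmax | hmax
  · have := hd.le t hmax hts
    have h1 : 0 < (reduceMod (2 * n) ψ v).support.card :=
      Finset.card_pos.2 (nonempty_support_iff.2 hne)
    exact (this.trans (Nat.le_mul_of_pos_right _ h1)).trans hwt
  · have h2 : 2 ≤ (reduceMod (2 * n) ψ v).support.card := by
      rcases lt_max_iff.1 hmax with h | h
      · exact two_le_card_support_of_dvd hf (coeff_zero_X_pow_sub_C hn ha) hne
          (dvd_reduceMod h2n (hfac ▸ dvd_mul_right _ _) (hfv h))
      · exact two_le_card_support_of_dvd hg (coeff_zero_X_pow_sub_C hn hb) hne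
          (dvd_reduceMod h2n (hfac ▸ dvd_mul_left _ _) (hgv h))
    refine (hd.le_two_mul t hmin hts).trans (le_trans ?_ hwt)
    rw [mul_comm]
    exact Nat.mul_le_mul_left _ h2

/-- The multiples `(f * g) ^ t` for `t ≥ max i j`, and `f ^ (p ^ s) * g ^ t` or `f ^ t * g ^ (p ^ s)`
for `t ≥ min i j`, have low weight, because `f ^ (p ^ s)` and `g ^ (p ^ s)` are binomials. -/
lemma exists_card_support_le [CharP F p] (hp : p.Prime) (hn : 0 < n)
    (hfac : (X ^ (2 * n) - C ψ : F[X]) = (X ^ n - C a) * (X ^ n - C b))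
    {i j d : ℕ} (hi : i ≤ p ^ s) (hj : j ≤ p ^ s) (hd : IsDigitMin p s i j d) :
    ∃ w : F[X], w ≠ 0 ∧ w.degree < ((2 * n * p ^ s : ℕ) : WithBot ℕ) ∧
      (X ^ n - C a) ^ i * (X ^ n - C b) ^ j ∣ w ∧ w.support.card ≤ d := by
  have : Fact p.Prime := ⟨hp⟩
  have hne : ∀ t u, (X ^ n - C a : F[X]) ^ t * (X ^ n - C b) ^ u ≠ 0 := fun t u =>
    mul_ne_zero (pow_ne_zero _ (X_pow_sub_C_ne_zero hn a)) (pow_ne_zero _ (X_pow_sub_C_ne_zero hn b))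
  have hbin : ∀ c : F, ((X ^ n - C c : F[X]) ^ p ^ s).support.card ≤ 2 := fun c => by
    have e : (X ^ n - C c : F[X]) ^ p ^ s = (X ^ (n * p ^ s) - C (c ^ p ^ s)) ^ 1 := by
      rw [sub_pow_char_pow, ← C_pow, pow_one, pow_mul]
    rw [e]
    refine (card_support_X_pow_sub_C_pow_le hp _ _ _).trans ?_
    have := digitProd_mul_add hp.one_lt 0 hp.one_lt
    simp [show digitProd p 1 = 2 by simpa using this]
  have hdegs : ∀ t u, t + u < 2 * p ^ s →
      ((X ^ n - C a) ^ t * (X ^ n - C b) ^ u).degree < ((2 * n * p ^ s : ℕ) : WithBot ℕ) := by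
    intro t u h
    rw [degree_X_pow_sub_C_mul_pow hn]
    norm_cast
    calc n * t + n * u = n * (t + u) := by ring
      _ < n * (2 * p ^ s) := Nat.mul_lt_mul_of_pos_left h hn
      _ = _ := by ring
  rcases hd.attained with ⟨t, ht1, ht2, ht⟩ | ⟨t, ht1, ht2, ht⟩
  · rcases min_le_iff.1 ht1 with h | h
    · refine ⟨_, hne t (p ^ s), hdegs _ _ (by omega),
        mul_dvd_mul (pow_dvd_pow _ h) (pow_dvd_pow _ hj), ?_⟩
      refine card_support_mul_le.trans (le_trans ?_ ht)
      rw [mul_comm]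
      exact Nat.mul_le_mul (hbin b) (card_support_X_pow_sub_C_pow_le hp _ _ _)
    · refine ⟨_, hne (p ^ s) t, hdegs _ _ (by omega),
        mul_dvd_mul (pow_dvd_pow _ hi) (pow_dvd_pow _ h), ?_⟩
      refine card_support_mul_le.trans (le_trans ?_ ht)
      exact Nat.mul_le_mul (hbin a) (card_support_X_pow_sub_C_pow_le hp _ _ _)
  · rw [max_le_iff] at ht1
    refine ⟨_, hne t t, hdegs _ _ (by omega),
      mul_dvd_mul (pow_dvd_pow _ ht1.1) (pow_dvd_pow _ ht1.2), ?_⟩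
    rw [← mul_pow, ← hfac]
    exact (card_support_X_pow_sub_C_pow_le hp _ _ _).trans ht

end Weights

end Constacyclic

/-! ### The classification and the distances -/

open Constacyclic

theorem theorem4p22 {F : Type*} [Field F] [Finite F] [DecidableEq F]
    (p : ℕ) (hp : p.Prime) (hp2 : p ≠ 2) [CharP F p]
    (s n : ℕ) (hs : 0 < s) (hn : 0 < n)
    (lam ξ ψ : F) (hlam0 : lam ≠ 0) (hξ0 : ξ ≠ 0) (hψ0 : ψ ≠ 0)
    (hlam : lam = ψ ^ p ^ s)
    (hfac : (X ^ (2 * n) - C ψ : F[X]) = (X ^ n - C ξ) * (X ^ n + C ξ))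
    (hirr₁ : Irreducible (X ^ n - C ξ : F[X])) (hirr₂ : Irreducible (X ^ n + C ξ : F[X])) :
    -- the `lam`-cyclic codes of length `2 n p^s` are exactly the codes with these generators
    (∀ D : Submodule F (Fin (2 * n * p ^ s) → F),
      Constacyclic.IsConstacyclic lam D ↔
        ∃ i j : ℕ, i ≤ p ^ s ∧ j ≤ p ^ s ∧
          D = Constacyclic.genCode (2 * n * p ^ s) lam n ξ i j) ∧
    -- the two trivial codes
    Constacyclic.genCode (2 * n * p ^ s) lam n ξ 0 0 = ⊤ ∧
    Constacyclic.genCode (2 * n * p ^ s) lam n ξ (p ^ s) (p ^ s) = ⊥ ∧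
    -- every other code is covered by the table, and its minimum distance is the value given there
    (∀ i j : ℕ, i ≤ p ^ s → j ≤ p ^ s → (i, j) ≠ (0, 0) → (i, j) ≠ (p ^ s, p ^ s) →
      (∃ d : ℕ, Constacyclic.Table p s i j d) ∧
      ∀ d : ℕ, Constacyclic.Table p s i j d →
        Constacyclic.IsMinHammingDist (Constacyclic.genCode (2 * n * p ^ s) lam n ξ i j) d) := by
  have : Fact p.Prime := ⟨hp⟩
  have hp3 : 2 < p := lt_of_le_of_ne hp.two_le hp2.symm
  have hN : 0 < 2 * n * p ^ s := by have := hp.pos; positivity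
  have hadd : (X ^ n + C ξ : F[X]) = X ^ n - C (-ξ) := by simp
  have hmod : (X ^ (2 * n * p ^ s) - C lam : F[X])
      = (X ^ n - C ξ) ^ p ^ s * (X ^ n + C ξ) ^ p ^ s := by
    rw [← mul_pow, ← hfac, sub_pow_char_pow, ← pow_mul, ← C_pow, hlam]
  have hmem : ∀ {i j}, i ≤ p ^ s → j ≤ p ^ s → ∀ c : Fin (2 * n * p ^ s) → F,
      c ∈ genCode (2 * n * p ^ s) lam n ξ i j ↔
        (X ^ n - C ξ) ^ i * (X ^ n + C ξ) ^ j ∣ wordPoly c := fun hi hj c =>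
    mk_mem_span_mk_iff (hmod ▸ mul_dvd_mul (pow_dvd_pow _ hi) (pow_dvd_pow _ hj))
  refine ⟨fun D => ⟨fun hD => ?_, ?_⟩, ?_, ?_, fun i j hi hj h0 h1 =>
    ⟨exists_table hp3 hs hi hj h0 h1, fun d hd => ?_⟩⟩
  · obtain ⟨h, hdvd, hDh⟩ := hD.exists_dvd hN
    rw [hmod] at hdvd
    obtain ⟨h₁, h₂, hh₁, hh₂, rfl⟩ := exists_dvd_and_dvd_of_dvd_mul hdvd
    obtain ⟨i, hi, hi'⟩ := (dvd_prime_pow hirr₁.prime _).1 hh₁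
    obtain ⟨j, hj, hj'⟩ := (dvd_prime_pow hirr₂.prime _).1 hh₂
    refine ⟨i, j, hi, hj, ?_⟩
    ext c
    rw [hDh, hmem hi hj, (hi'.mul_mul hj').dvd_iff_dvd_left]
  · rintro ⟨i, j, -, -, rfl⟩
    exact isConstacyclic_codeOfIdeal hN _
  · ext c
    simp [hmem (Nat.zero_le _) (Nat.zero_le _)]
  · ext c
    rw [hmem le_rfl le_rfl, ← hmod, Submodule.mem_bot]
    refine ⟨fun h => wordPoly_injective ?_, fun h => by simp [h]⟩
    rw [wordPoly_zero]
    refine eq_zero_of_dvd_of_degree_lt h ?_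
    rw [degree_X_pow_sub_C hN]
    exact degree_wordPoly_lt c
  · have hmin : IsDigitMin p s i j d := by
      rcases hd with hd | hd
      · exact hd.isDigitMin hp3 hs h0
      · exact (hd.isDigitMin hp3 hs fun h => h0 (by rw [Prod.mk.injEq] at h ⊢; exact h.symm)).symm
    have hξ : ξ ≠ -ξ := fun h => by
      have h2 : (2 : F) * ξ = 0 := by linear_combination h
      rcases mul_eq_zero.1 h2 with h2 | h2
      · have : ((2 : ℕ) : F) = 0 := by exact_mod_cast h2
        rw [CharP.cast_eq_zero_iff F p] at this
        exact absurd (Nat.le_of_dvd two_pos this) (by omega)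
      · exact hξ0 h2
    rw [hadd] at hfac hirr₂
    have hlow : ∀ u ∈ genCode (2 * n * p ^ s) lam n ξ i j,
        ∀ v ∈ genCode (2 * n * p ^ s) lam n ξ i j, u ≠ v → d ≤ hammingDist u v := by
      intro u hu v hv huv
      have huv' := (hmem hi hj _).1 (Submodule.sub_mem _ hv hu)
      rw [hadd] at huv'
      rw [hammingDist_eq_hammingNorm, neg_add_eq_sub, hammingNorm_eq_card_support]
      refine le_card_support hp hn hψ0 hξ0 (neg_ne_zero.2 hξ0) hξ hfac hirr₁ hirr₂ hmin ?_
        (degree_wordPoly_lt _) huv'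
      rw [wordPoly_sub, sub_ne_zero]
      exact wordPoly_injective.ne huv.symm
    obtain ⟨w, hw0, hwdeg, hwdvd, hwd⟩ := exists_card_support_le hp hn hfac hi hj hmin
    have hwp := wordPoly_coeff hwdeg
    have hwmem : (fun k : Fin (2 * n * p ^ s) => w.coeff k) ∈
        genCode (2 * n * p ^ s) lam n ξ i j := by
      rw [hmem hi hj, hwp, hadd]
      exact hwdvd
    have hw0' : (fun k : Fin (2 * n * p ^ s) => w.coeff k) ≠ 0 := fun h =>
      hw0 (by rw [← hwp, h, wordPoly_zero])
    refine ⟨⟨_, hwmem, 0, Submodule.zero_mem _, hw0', le_antisymm ?_ ?_⟩, ?_⟩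
    · rwa [hammingDist_zero_right, hammingNorm_eq_card_support, hwp]
    · exact hlow _ hwmem _ (Submodule.zero_mem _) hw0'
    · rintro _ ⟨u, hu, v, hv, huv, rfl⟩
      exact hlow u hu v hv huv
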